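/- Let $D$ be a chord diagram with $N\ge 0$ chords on an oriented line, the chords being numbered from left to right by their left end-points. **Weight system.** Let $V$ be the free $\mathbb Q[\lambda]$-module on $v_0,v_1,v_2,\dots$ with the operators $Ev_k=(\lambda-k+1)v_{k-1}$ (where $v_{-1}=0$), $Fv_k=(k+1)v_{k+1}$, $Hv_k=(\lambda-2k)v_k$, and put $\hat B=F\otimes E+E\otimes F+\tfrac12 H\otimes H-\tfrac12\lambda(\lambda+2)\,1\otimes 1$. The $0$-framed colored Jones weight system $W_J(D)\in\mathbb Q[\lambda]$ is obtained by coloring each chord of $D$ with $\hat B$ (the left tensor factor at its left end-point, the right tensor factor at its right end-point), applying the operators along the line from left to right to $v_0$, and taking the coefficient of $v_0$; it equals $1$ if $D$ has no chords. Substitute $\lambda=d-2$ and, for $n\ge 0$, let $W_{JJ^{(n)}}(D)$ be the coefficient of $d^{N-n}$ in the resulting polynomial in $d$ (which is $0$ if $n>N$). **Labeled intersection digraph.** $\mathrm{LID}(D)$ has the chords of $D$ as vertices. It has one uncolored loop at each vertex, an uncolored arc $(i,j)$ for each pair of intersecting chords $i<j$, and a red arc $(i,j)$ for each pair of chords such that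 $i$ is completely contained in $j$. **Acceptable objects.** A thickened arc is an arc together with one of its two ends, at which it is said to be thickened. An acceptable object $K$ for $\mathrm{LID}(D)$ is a set of thickened arcs of the following kinds: a loop, thickened at its initial segment; an uncolored arc $(i,j)$, $i\ne j$, of $\mathrm{LID}(D)$, thickened at either end (the two thickenings are different thickened arcs, and both may belong to $K$); for a red arc $(i,j)$ of $\mathrm{LID}(D)$, the arc $(i,j)$ thickened at $i$ and the reversed arc $(j,i)$ thickened at $i$ (both may belong to $K$). It is required that each vertex has degree $0$, $2$ or $4$ in $K$, a loop contributing $2$ to the degree; that the number of arcs of $K$ thickened at a vertex is half the degree of that vertex in $K$; and that, if two arcs of $K$ are thickened at the same vertex, one of them enters and the other leaves that vertex, a loop being considered as leaving. Let $\deg_4(K)$ be the number of vertices of degree $4$ in $K$, and $a(K)$ the number of arcs of $K$ whose initial segment is thickened. **Claim.** For every $n\ge 0$, $$W_{JJ^{(n)}}(D)=2^n\sum_{K}(-1)^{a(K)},$$ where the sum is over all acceptable objects $K$ for $\mathrm{LID}(D)$ with $\deg_4(K)=n$. -/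

import Mathlib

open Polynomial

/-! ## Chord diagrams -/

/-- A chord diagram with `N` chords on an oriented line. The `2 * N` end-points of the chords are
the elements of `Fin (2 * N)`, from left to right, and the chords are numbered from left to right,
i.e. in the order of their left end-points. -/
structure ChordDiagram (N : ℕ) where
  /-- the left end-point of a chord -/
  left : Fin N → Fin (2 * N)
  /-- the right end-point of a chord -/
  right : Fin N → Fin (2 * N)
  left_lt_right : ∀ i, left i < right i
  left_strictMono : StrictMono left
  bijective_ends : Function.Bijective (Sum.elim left right)

/-! ## The colored Jones weight system -/

/-- The underlying space of the `sl₂`-module of highest weight `lam`, where `lam` is the variable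
`X` of `ℚ[X]`: the free `ℚ[X]`-module on `v₀, v₁, v₂, …`. -/
abbrev Verma : Type := ℕ →₀ ℚ[X]

namespace Verma

/-- The basis vector `v_k`. -/
noncomputable def basisVec (k : ℕ) : Verma := Finsupp.single k 1

/-- The raising operator, `E v_k = (lam - k + 1) v_{k-1}` with `v_{-1} = 0`. -/
noncomputable def E : Module.End ℚ[X] Verma :=
  Finsupp.linearCombination ℚ[X] fun k : ℕ =>
    if k = 0 then (0 : Verma) else ((X : ℚ[X]) - (k : ℚ[X]) + 1) • basisVec (k - 1)

/-- The lowering operator, `F v_k = (k + 1) v_{k+1}`. -/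
noncomputable def F : Module.End ℚ[X] Verma :=
  Finsupp.linearCombination ℚ[X] fun k : ℕ => ((k : ℚ[X]) + 1) • basisVec (k + 1)

/-- The weight operator, `H v_k = (lam - 2 k) v_k`. -/
noncomputable def H : Module.End ℚ[X] Verma :=
  Finsupp.linearCombination ℚ[X] fun k : ℕ => ((X : ℚ[X]) - 2 * (k : ℚ[X])) • basisVec k

end Verma

/-- The four summands of the `0`-framed Casimir tensor
`B = F ⊗ E + E ⊗ F + (1/2) (H ⊗ H) - (1/2) lam (lam + 2) (1 ⊗ 1)`. -/
inductive CasimirTerm : Type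
  | FE | EF | HH | II
  deriving DecidableEq

instance : Fintype CasimirTerm :=
  ⟨{.FE, .EF, .HH, .II}, fun t => by cases t <;> decide⟩

namespace CasimirTerm

/-- The left tensor factor of a summand of `B`. -/
noncomputable def leftOp : CasimirTerm → Module.End ℚ[X] Verma
  | FE => Verma.F
  | EF => Verma.E
  | HH => (C (1 / 2 : ℚ) : ℚ[X]) • Verma.H
  | II => (-(C (1 / 2 : ℚ) * (X * (X + 2))) : ℚ[X]) • 1

/-- The right tensor factor of a summand of `B`. -/
noncomputable def rightOp : CasimirTerm → Module.End ℚ[X] Verma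
  | FE => Verma.E
  | EF => Verma.F
  | HH => Verma.H
  | II => 1

end CasimirTerm

namespace ChordDiagram

variable {N : ℕ}

/-- The chord ending at the end-point `p`; `Sum.inl i` if `p` is the left end-point of the chord
`i`, and `Sum.inr i` if it is the right one. -/
noncomputable def chordAt (D : ChordDiagram N) (p : Fin (2 * N)) : Fin N ⊕ Fin N :=
  (Equiv.ofBijective _ D.bijective_ends).symm p

/-- The operator at the end-point `p`, when each chord `i` is colored by the summand `ρ i` of `B`:
the left factor of `ρ i` at the left end-point of `i`, the right factor at the right one. -/
noncomputable def opAt (D : ChordDiagram N) (ρ : Fin N → CasimirTerm) (p : Fin (2 * N)) :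
    Module.End ℚ[X] Verma :=
  Sum.elim (fun i => (ρ i).leftOp) (fun i => (ρ i).rightOp) (D.chordAt p)

/-- The `0`-framed colored Jones weight system `W_J(D)`, a polynomial in `lam = X`: color each
chord of `D` by the tensor `B`, apply the resulting operators along the line, from left to right,
to the highest weight vector `v₀`, and take the coefficient of `v₀`. It is `1` on the diagram
without chords. -/
noncomputable def WJ (D : ChordDiagram N) : ℚ[X] :=
  ∑ ρ : Fin N → CasimirTerm,
    ((List.finRange (2 * N)).foldl (fun v p => D.opAt ρ p v) (Verma.basisVec 0)) 0

/-- `W_J(D)` as a polynomial in `d = lam + 2`, i.e. after the substitution `lam = d - 2`. -/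
noncomputable def WJd (D : ChordDiagram N) : ℚ[X] := D.WJ.comp (X - 2)

/-- The coefficient of `d ^ (N - n)` in `W_J(D)`, where `d = lam + 2` and `N` is the number of
chords of `D`; it is `0` if the exponent `N - n` is negative. -/
noncomputable def WJJ (n : ℕ) (D : ChordDiagram N) : ℚ :=
  if n ≤ N then D.WJd.coeff (N - n) else 0

/-- The chords `i` and `j` intersect, and `i` is the smaller one (the one on the left). -/
def CrossesLeft (D : ChordDiagram N) (i j : Fin N) : Prop :=
  D.left i < D.left j ∧ D.left j < D.right i ∧ D.right i < D.right j

/-- The chord `i` is completely contained in the chord `j`. -/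
def ContainedIn (D : ChordDiagram N) (i j : Fin N) : Prop :=
  D.left j < D.left i ∧ D.right i < D.right j

end ChordDiagram

/-! ## Digraphs with red arcs, and acceptable objects -/

/-- A digraph with vertex set `V`, some of whose arcs are red, with exactly one loop at each vertex
(the loops are uncolored and implicit), and with at most one arc between two distinct vertices. -/
structure RedDigraph (V : Type*) where
  /-- `(u, v)` is an uncolored arc which is not a loop -/
  uncolored : V → V → Prop
  /-- `(u, v)` is a red arc -/
  red : V → V → Prop
  uncolored_asymm : ∀ u v, uncolored u v → ¬ uncolored v u
  red_asymm : ∀ u v, red u v → ¬ red v u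
  not_red_of_uncolored : ∀ u v, uncolored u v → ¬ red u v ∧ ¬ red v u

/-- An arc `(src, tgt)` with a thickening of one of its ends: of the initial segment if `atSrc` is
`true`, and of the terminal segment if it is `false`. -/
structure ThickArc (V : Type*) where
  src : V
  tgt : V
  atSrc : Bool
  deriving DecidableEq, Fintype

namespace ThickArc

variable {V : Type*}

/-- The vertex at which a thickened arc is thickened. -/
def thickEnd (e : ThickArc V) : V := if e.atSrc = true then e.src else e.tgt

end ThickArc

namespace RedDigraph

variable {V : Type*}

/-- The thickened arcs which may appear in an acceptable object for `G`: a loop thickened at its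
initial segment; an uncolored arc thickened at any of its ends; and, for a red arc `(i, j)` of `G`,
the arcs `(i, j)` and `(j, i)`, both thickened at `i`. -/
def Permitted (G : RedDigraph V) (e : ThickArc V) : Prop :=
  (e.src = e.tgt ∧ e.atSrc = true) ∨
  G.uncolored e.src e.tgt ∨
  (G.red e.src e.tgt ∧ e.atSrc = true) ∨
  (G.red e.tgt e.src ∧ e.atSrc = false)

variable [DecidableEq V]

/-- The degree of `v` in a collection of thickened arcs: the number of arcs incident with `v`,
where a loop contributes `2`. -/
def deg (K : Finset (ThickArc V)) (v : V) : ℕ :=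
  (K.filter fun e => e.src = v).card + (K.filter fun e => e.tgt = v).card

/-- The number of arcs of `K` which are thickened at `v`. -/
def thickDeg (K : Finset (ThickArc V)) (v : V) : ℕ :=
  (K.filter fun e => e.thickEnd = v).card

/-- The number of vertices of degree `4` in `K`. -/
def deg4 [Fintype V] (K : Finset (ThickArc V)) : ℕ :=
  (Finset.univ.filter fun v : V => deg K v = 4).card

/-- The number `a(K)` of arcs of `K` whose initial segment is thickened. -/
def agree (K : Finset (ThickArc V)) : ℕ :=
  (K.filter fun e => e.atSrc = true).card

/-- Acceptable objects for `G`. An arc thickened at `v` leaves `v` if its initial segment is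
thickened (as for loops) and enters `v` otherwise. -/
structure Acceptable (G : RedDigraph V) (K : Finset (ThickArc V)) : Prop where
  permitted : ∀ e ∈ K, G.Permitted e
  deg_eq : ∀ v, deg K v = 0 ∨ deg K v = 2 ∨ deg K v = 4
  half : ∀ v, 2 * thickDeg K v = deg K v
  enters_leaves : ∀ v, ∀ e ∈ K, ∀ f ∈ K, e ≠ f → e.thickEnd = v → f.thickEnd = v →
    e.atSrc ≠ f.atSrc

open Classical in
/-- The set of the acceptable objects for `G` with exactly `n` vertices of degree `4`. -/
noncomputable def acceptableWithDeg4 [Fintype V] (G : RedDigraph V) (n : ℕ) :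
    Finset (Finset (ThickArc V)) :=
  Finset.univ.filter fun K => G.Acceptable K ∧ deg4 K = n

end RedDigraph

/-- The labeled intersection digraph of a chord diagram: its vertices are the chords, two
intersecting chords are joined by an uncolored arc from the smaller to the larger one, there is a
red arc `(i, j)` if `i` is completely contained in `j`, and there is a loop at each vertex. -/
def ChordDiagram.LID {N : ℕ} (D : ChordDiagram N) : RedDigraph (Fin N) where
  uncolored := D.CrossesLeft
  red := D.ContainedIn
  uncolored_asymm := fun _ _ h h' => lt_asymm h.1 h'.1
  red_asymm := fun _ _ h h' => lt_asymm h.1 h'.1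
  not_red_of_uncolored := fun _ _ h =>
    ⟨fun h' => lt_asymm h.1 h'.1, fun h' => lt_asymm h.2.2 h'.2⟩

/-! ## The Verma module as a polynomial ring -/

namespace Verma

/-- The Verma module inside the polynomial ring: `v_k` is sent to `z ^ k / k!`. -/
noncomputable def toPoly : Verma →ₗ[ℚ[X]] ℚ[X][X] :=
  Finsupp.linearCombination ℚ[X] fun k : ℕ => monomial k (C ((k.factorial : ℚ)⁻¹) : ℚ[X])

lemma toPoly_basisVec (k : ℕ) :
    toPoly (basisVec k) = monomial k (C ((k.factorial : ℚ)⁻¹) : ℚ[X]) := by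
  simp [toPoly, basisVec]

lemma coeff_zero_toPoly (v : Verma) : (toPoly v).coeff 0 = v 0 := by
  induction v using Finsupp.induction_linear with
  | zero => simp
  | add f g hf hg => simp [hf, hg]
  | single k c =>
    rw [toPoly, Finsupp.linearCombination_single, smul_monomial, coeff_monomial]
    rcases k with _ | k <;> simp

/-- Two linear maps out of the Verma module agree if they agree on the basis vectors. -/
lemma hom_ext {M : Type*} [AddCommMonoid M] [Module ℚ[X] M] {f g : Verma →ₗ[ℚ[X]] M}
    (h : ∀ k, f (basisVec k) = g (basisVec k)) : f = g := by
  refine Finsupp.lhom_ext' fun k => LinearMap.ext_ring ?_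
  simpa [basisVec] using h k

lemma F_basisVec (k : ℕ) : F (basisVec k) = ((k : ℚ[X]) + 1) • basisVec (k + 1) := by
  simp [F, basisVec]

lemma E_basisVec_zero : E (basisVec 0) = 0 := by
  simp [E, basisVec]

lemma E_basisVec_succ (k : ℕ) : E (basisVec (k + 1)) = ((X : ℚ[X]) - k) • basisVec k := by
  have h : (X : ℚ[X]) - ((k + 1 : ℕ) : ℚ[X]) + 1 = X - (k : ℚ[X]) := by push_cast; ring
  rw [E, basisVec, Finsupp.linearCombination_single, if_neg k.succ_ne_zero, h, one_smul,
    Nat.add_sub_cancel]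

lemma H_basisVec (k : ℕ) : H (basisVec k) = ((X : ℚ[X]) - 2 * (k : ℚ[X])) • basisVec k := by
  simp [H, basisVec]

end Verma

/-- Multiplication by `z ^ a`, followed by the divided power `∂ ^ k / k!` of the derivation. -/
noncomputable def mulThenDeriv {R : Type*} [CommRing R] (a k : ℕ) : Module.End R R[X] :=
  hasseDeriv k ∘ₗ LinearMap.mulLeft R (X ^ a)

lemma mulThenDeriv_apply {R : Type*} [CommRing R] (a k : ℕ) (f : R[X]) :
    mulThenDeriv a k f = hasseDeriv k (X ^ a * f) := rfl

lemma mulThenDeriv_monomial {R : Type*} [CommRing R] (a k j : ℕ) (r : R) :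
    mulThenDeriv a k (monomial j r) = monomial (j + a - k) (((j + a).choose k : R) * r) := by
  rw [mulThenDeriv_apply, X_pow_mul_monomial, hasseDeriv_monomial]

namespace CasimirTerm

open Verma

/-- The coefficients of `E = d ∂ - ∂² z`. -/
noncomputable def coeffE (m : Fin 2 × Fin 3) : ℚ[X] := ![![0, X + 2, 0], ![0, 0, -2]] m.1 m.2

/-- The coefficients of `F = z`. -/
noncomputable def coeffF (m : Fin 2 × Fin 3) : ℚ[X] := ![![0, 0, 0], ![1, 0, 0]] m.1 m.2

/-- The coefficients of `H = d - 2 ∂ z`. -/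
noncomputable def coeffH (m : Fin 2 × Fin 3) : ℚ[X] := ![![X + 2, 0, 0], ![0, -2, 0]] m.1 m.2

/-- The coefficients of the identity. -/
noncomputable def coeffI (m : Fin 2 × Fin 3) : ℚ[X] := ![![1, 0, 0], ![0, 0, 0]] m.1 m.2

/-- The combination of the operators `mulThenDeriv` with the given coefficients. -/
noncomputable def combo (c : Fin 2 × Fin 3 → ℚ[X]) : Module.End ℚ[X] ℚ[X][X] :=
  ∑ m, c m • mulThenDeriv (m.1 : ℕ) (m.2 : ℕ)

lemma combo_apply (c : Fin 2 × Fin 3 → ℚ[X]) (f : ℚ[X][X]) :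
    combo c f = ∑ m, c m • mulThenDeriv (m.1 : ℕ) (m.2 : ℕ) f := by
  simp [combo]

lemma combo_smul (r : ℚ[X]) (c : Fin 2 × Fin 3 → ℚ[X]) : combo (r • c) = r • combo c := by
  simp [combo, Finset.smul_sum, smul_smul]

lemma C_inv_factorial_succ (k : ℕ) :
    ((k : ℚ[X]) + 1) * C (((k + 1).factorial : ℚ)⁻¹) = C ((k.factorial : ℚ)⁻¹) := by
  have h : ((k : ℚ[X]) + 1) = C ((k : ℚ) + 1) := by simp
  rw [h, ← C_mul]
  congr 1
  rw [Nat.factorial_succ]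
  push_cast
  field_simp

lemma toPoly_F : toPoly ∘ₗ F = combo coeffF ∘ₗ toPoly := by
  refine hom_ext fun k => ?_
  simp only [LinearMap.comp_apply, F_basisVec, map_smul, toPoly_basisVec, combo_apply,
    mulThenDeriv_monomial, Fintype.sum_prod_type, Fin.sum_univ_two, Fin.sum_univ_three, coeffF,
    smul_monomial, smul_eq_mul, C_inv_factorial_succ]
  simp

lemma toPoly_E : toPoly ∘ₗ E = combo coeffE ∘ₗ toPoly := by
  refine hom_ext fun k => ?_
  rcases k with _ | k
  · simp only [LinearMap.comp_apply, E_basisVec_zero, map_zero, toPoly_basisVec, combo_apply,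
      mulThenDeriv_monomial, Fintype.sum_prod_type, Fin.sum_univ_two, Fin.sum_univ_three, coeffE]
    simp
  · simp only [LinearMap.comp_apply, E_basisVec_succ, map_smul, toPoly_basisVec, combo_apply,
      mulThenDeriv_monomial, Fintype.sum_prod_type, Fin.sum_univ_two, Fin.sum_univ_three, coeffE,
      smul_monomial, smul_eq_mul]
    have hc : (((k + 1 + 1).choose 2 : ℕ) : ℚ[X]) * 2 = (k + 1) * (k + 2) := by
      have := Nat.triangle_succ (k + 1)
      have h2 : (k + 1 + 1).choose 2 * 2 = (k + 1) * (k + 2) := by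
        rw [Nat.choose_two_right, Nat.div_mul_cancel (Nat.even_mul_pred_self _).two_dvd]
        simp; ring
      exact_mod_cast h2
    simp
    rw [← map_neg, ← map_add, ← C_inv_factorial_succ]
    congr 1
    linear_combination C (((k + 1).factorial : ℚ)⁻¹) * hc

lemma toPoly_H : toPoly ∘ₗ H = combo coeffH ∘ₗ toPoly := by
  refine hom_ext fun k => ?_
  simp only [LinearMap.comp_apply, H_basisVec, map_smul, toPoly_basisVec, combo_apply,
    mulThenDeriv_monomial, Fintype.sum_prod_type, Fin.sum_univ_two, Fin.sum_univ_three, coeffH,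
    smul_monomial, smul_eq_mul]
  simp
  rw [← map_neg, ← map_add]
  congr 1
  ring

lemma combo_coeffI : combo coeffI = 1 := by
  refine LinearMap.ext fun f => ?_
  simp only [combo_apply, Fintype.sum_prod_type, Fin.sum_univ_two, Fin.sum_univ_three, coeffI,
    mulThenDeriv_apply]
  simp

/-- The coefficients of the left factor of a summand of the Casimir tensor. -/
noncomputable def leftCoeff : CasimirTerm → Fin 2 × Fin 3 → ℚ[X]
  | FE => coeffF
  | EF => coeffE
  | HH => (C (1 / 2 : ℚ) : ℚ[X]) • coeffH
  | II => (-(C (1 / 2 : ℚ) * (X * (X + 2))) : ℚ[X]) • coeffI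

/-- The coefficients of the right factor of a summand of the Casimir tensor. -/
noncomputable def rightCoeff : CasimirTerm → Fin 2 × Fin 3 → ℚ[X]
  | FE => coeffE
  | EF => coeffF
  | HH => coeffH
  | II => coeffI

lemma toPoly_leftOp (t : CasimirTerm) (v : Verma) :
    toPoly (t.leftOp v) = combo t.leftCoeff (toPoly v) := by
  have hE := LinearMap.congr_fun toPoly_E v
  have hF := LinearMap.congr_fun toPoly_F v
  have hH := LinearMap.congr_fun toPoly_H v
  cases t <;> simp_all only [leftOp, leftCoeff, combo_smul, combo_coeffI, LinearMap.smul_apply,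
    LinearMap.comp_apply, map_smul, Module.End.one_apply]

lemma toPoly_rightOp (t : CasimirTerm) (v : Verma) :
    toPoly (t.rightOp v) = combo t.rightCoeff (toPoly v) := by
  have hE := LinearMap.congr_fun toPoly_E v
  have hF := LinearMap.congr_fun toPoly_F v
  have hH := LinearMap.congr_fun toPoly_H v
  cases t <;> simp_all [rightOp, rightCoeff, combo_coeffI]

/-- The weight of a chord, according to the powers of `z` at its two end-points. -/
noncomputable def endWeight (a b : Fin 2) : ℚ[X] := ![![X + 2, X + 2], ![-(X + 2), -2]] a b

lemma sum_leftCoeff_mul_rightCoeff (m m' : Fin 2 × Fin 3) :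
    ∑ t, leftCoeff t m * rightCoeff t m' = endWeight m.1 m'.1 *
      if (m.2 : ℕ) + (m'.2 : ℕ) = (m.1 : ℕ) + (m'.1 : ℕ) then (-1) ^ (m'.2 : ℕ) else 0 := by
  have hs : ∀ f : CasimirTerm → ℚ[X], ∑ t, f t = f FE + (f EF + (f HH + f II)) := fun f => by
    change ∑ t ∈ ({.FE, .EF, .HH, .II} : Finset CasimirTerm), f t = _
    rw [Finset.sum_insert (by decide), Finset.sum_insert (by decide),
      Finset.sum_insert (by decide), Finset.sum_singleton]
  have hC : (C (1 / 2 : ℚ) : ℚ[X]) * 2 = 1 := by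
    have h2 : (2 : ℚ[X]) = C 2 := (map_ofNat C 2).symm
    rw [h2, ← C_mul]
    norm_num
  simp only [hs, leftCoeff, rightCoeff, Pi.smul_apply, smul_eq_mul]
  generalize (C (1 / 2 : ℚ) : ℚ[X]) = h at hC
  obtain ⟨a, k⟩ := m
  obtain ⟨a', k'⟩ := m'
  fin_cases a <;> fin_cases a' <;> fin_cases k <;> fin_cases k' <;>
    simp [coeffE, coeffF, coeffH, coeffI, endWeight] <;>
    first
    | linear_combination (X + 2 : ℚ[X]) * hC
    | linear_combination (-X - 2 : ℚ[X]) * hC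
    | linear_combination hC

end CasimirTerm

/-! ## Vacuum expectations -/

lemma List.foldl_end_apply {R M P : Type*} [CommSemiring R] [AddCommMonoid M] [Module R M]
    (A : P → Module.End R M) (l : List P) (v : M) :
    l.foldl (fun v p => A p v) v = (l.map fun p => MulOpposite.op (A p)).prod.unop v := by
  induction l generalizing v with
  | nil => simp
  | cons p l ih => simp [ih]

/-- Multilinear expansion of a composition of linear combinations of operators. -/
lemma foldl_sum_smul {R M ι : Type*} [CommRing R] [AddCommGroup M] [Module R M] [Fintype ι]
    (n : ℕ) (c : Fin n → ι → R) (A : ι → Module.End R M) (v : M) :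
    (List.finRange n).foldl (fun v p => (∑ m, c p m • A m) v) v =
      ∑ m : Fin n → ι, (∏ p, c p (m p)) • (List.finRange n).foldl (fun v p => A (m p) v) v := by
  classical
  have key : ∀ B : Fin n → Module.End R M, (List.finRange n).foldl (fun v p => B p v) v =
      (MultilinearMap.mkPiAlgebraFin R n (Module.End R M)ᵐᵒᵖ
        (fun p => MulOpposite.op (B p))).unop v := fun B => by
    rw [List.foldl_end_apply, MultilinearMap.mkPiAlgebraFin_apply, List.ofFn_eq_map]
  rw [key]
  simp only [key, Finset.op_sum, MulOpposite.op_smul]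
  rw [MultilinearMap.map_sum]
  simp only [MultilinearMap.map_smul_univ, Finset.unop_sum, MulOpposite.unop_smul,
    LinearMap.sum_apply, LinearMap.smul_apply]

/-- The vacuum expectation of a product of operators `(∂ ^ k / k!) z ^ a`, as a coefficient of a
product of linear forms. -/
lemma coeff_zero_foldl_mulThenDeriv {R : Type*} [CommRing R] (n : ℕ) (a k : Fin n → ℕ)
    (f : R[X]) :
    ((List.finRange n).foldl (fun f p => mulThenDeriv (a p) (k p) f) f).coeff 0 =
      MvPolynomial.coeff (Finsupp.equivFunOnFinite.symm k)
        (aeval (∑ p, (MvPolynomial.X p : MvPolynomial (Fin n) R)) f *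
          ∏ p, (∑ q ∈ Finset.Ici p, (MvPolynomial.X q : MvPolynomial (Fin n) R)) ^ a p) := by
  induction n generalizing f with
  | zero =>
    have hk : Finsupp.equivFunOnFinite.symm k = 0 := Subsingleton.elim _ _
    rw [hk]
    simp [aeval_def, eval₂_at_zero, coeff_zero_eq_eval_zero]
  | succ n ih =>
    have hk : Finsupp.equivFunOnFinite.symm k =
        (Finsupp.equivFunOnFinite.symm fun p : Fin n => k p.succ).cons (k 0) := by
      ext p
      refine Fin.cases ?_ (fun p => ?_) p <;> simp
    rw [List.finRange_succ, List.foldl_cons, List.foldl_map, ih (fun p => a p.succ)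
      (fun p => k p.succ), hk, ← MvPolynomial.finSuccEquiv_coeff_coeff]
    congr 1
    set s : MvPolynomial (Fin n) R := ∑ p, MvPolynomial.X p with hs
    have hX : MvPolynomial.finSuccEquiv R n (∑ p, MvPolynomial.X p) = X + C s := by
      simp [Fin.sum_univ_succ, MvPolynomial.finSuccEquiv_X_zero,
        MvPolynomial.finSuccEquiv_X_succ, hs]
    have hI : Finset.Ici (0 : Fin (n + 1)) = Finset.univ := by ext; simp
    have hIs : ∀ p : Fin n, MvPolynomial.finSuccEquiv R n
        (∑ q ∈ Finset.Ici p.succ, MvPolynomial.X q) =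
        C (∑ q ∈ Finset.Ici p, (MvPolynomial.X q : MvPolynomial (Fin n) R)) := fun p => by
      rw [← Fin.map_succEmb_Ici, Finset.sum_map]
      simp [MvPolynomial.finSuccEquiv_X_succ]
    have hf : ∀ g : R[X], aeval (X + C s : (MvPolynomial (Fin n) R)[X]) g =
        taylor s (g.map MvPolynomial.C) := fun g => by
      rw [taylor_apply, comp, eval₂_map, aeval_def]
      rfl
    rw [map_mul, map_prod, Fin.prod_univ_succ, hI, map_pow, hX, ← mul_assoc,
      ← aeval_algHom_apply, hX]
    have hprod : ∏ p : Fin n, (MvPolynomial.finSuccEquiv R n)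
        ((∑ q ∈ Finset.Ici p.succ, MvPolynomial.X q) ^ a p.succ) =
        C (∏ p : Fin n, (∑ q ∈ Finset.Ici p, (MvPolynomial.X q : MvPolynomial (Fin n) R)) ^
          a p.succ) := by
      rw [map_prod]
      exact Finset.prod_congr rfl fun p _ => by rw [map_pow, hIs, C_pow]
    have hpow : (X + C s : (MvPolynomial (Fin n) R)[X]) ^ a 0 =
        aeval (X + C s : (MvPolynomial (Fin n) R)[X]) (X ^ a 0 : R[X]) := by simp
    have hmap : ∀ (j : ℕ) (g : R[X]),
        hasseDeriv j (g.map (MvPolynomial.C : R →+* MvPolynomial (Fin n) R)) =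
          (hasseDeriv j g).map MvPolynomial.C := fun j g => by
      ext i : 1
      simp [hasseDeriv_coeff]
    rw [hprod, coeff_mul_C, hpow, ← map_mul, mul_comm f, hf, taylor_coeff, hmap, eval_map,
      mulThenDeriv_apply, aeval_def]
    rfl

/-! ## The weight system as a sum of coefficients -/

namespace ChordDiagram

variable {N : ℕ} (D : ChordDiagram N)

lemma chordAt_left (i : Fin N) : D.chordAt (D.left i) = Sum.inl i := by
  rw [chordAt, Equiv.symm_apply_eq]
  rfl

lemma chordAt_right (i : Fin N) : D.chordAt (D.right i) = Sum.inr i := by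
  rw [chordAt, Equiv.symm_apply_eq]
  rfl

lemma left_or_right (p : Fin (2 * N)) : (∃ i, D.left i = p) ∨ ∃ i, D.right i = p := by
  obtain ⟨i | i, h⟩ := D.bijective_ends.2 p
  exacts [Or.inl ⟨i, h⟩, Or.inr ⟨i, h⟩]

lemma left_ne_right (i j : Fin N) : D.left i ≠ D.right j := fun h => by
  have := D.bijective_ends.1 (a₁ := Sum.inl i) (a₂ := Sum.inr j) h
  simp at this

lemma left_inj {i j : Fin N} : D.left i = D.left j ↔ i = j :=
  D.left_strictMono.injective.eq_iff

lemma right_inj {i j : Fin N} : D.right i = D.right j ↔ i = j :=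
  ⟨fun h => Sum.inr_injective (D.bijective_ends.1 (a₁ := Sum.inr i) (a₂ := Sum.inr j) h),
    congrArg _⟩

@[to_additive]
lemma prod_ends {M : Type*} [CommMonoid M] (f : Fin (2 * N) → M) :
    ∏ p, f p = (∏ i, f (D.left i)) * ∏ i, f (D.right i) := by
  rw [← (Equiv.ofBijective _ D.bijective_ends).prod_comp, Fintype.prod_sum_type]
  rfl

/-- The linear form `∑_{q ≥ p} y_q`. -/
noncomputable def tailForm {n : ℕ} (p : Fin n) : MvPolynomial (Fin n) ℚ[X] :=
  ∑ q ∈ Finset.Ici p, MvPolynomial.X q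

lemma foldl_opAt_apply_zero (ρ : Fin N → CasimirTerm) :
    ((List.finRange (2 * N)).foldl (fun v p => D.opAt ρ p v) (Verma.basisVec 0)) 0 =
      ∑ m : Fin (2 * N) → Fin 2 × Fin 3,
        (∏ i, (ρ i).leftCoeff (m (D.left i)) * (ρ i).rightCoeff (m (D.right i))) *
          MvPolynomial.coeff (Finsupp.equivFunOnFinite.symm fun p => ((m p).2 : ℕ))
            (∏ p, tailForm p ^ ((m p).1 : ℕ)) := by
  set c : Fin (2 * N) → Fin 2 × Fin 3 → ℚ[X] := fun p =>
    Sum.elim (fun i => (ρ i).leftCoeff) (fun i => (ρ i).rightCoeff) (D.chordAt p) with hc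
  have hop : ∀ p v, Verma.toPoly (D.opAt ρ p v) = CasimirTerm.combo (c p) (Verma.toPoly v) :=
    fun p v => by
      simp only [hc, opAt]
      rcases D.chordAt p with i | i
      · exact CasimirTerm.toPoly_leftOp _ _
      · exact CasimirTerm.toPoly_rightOp _ _
  have hfold : ∀ (l : List (Fin (2 * N))) (v : Verma),
      Verma.toPoly (l.foldl (fun v p => D.opAt ρ p v) v) =
        l.foldl (fun f p => CasimirTerm.combo (c p) f) (Verma.toPoly v) := fun l => by
    induction l with
    | nil => simp
    | cons p l ih => intro v; simp only [List.foldl_cons, ih, hop]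
  have hone : Verma.toPoly (Verma.basisVec 0) = 1 := by
    simp [Verma.toPoly_basisVec]
  rw [← Verma.coeff_zero_toPoly, hfold, hone]
  simp only [CasimirTerm.combo]
  rw [foldl_sum_smul _ c fun m => mulThenDeriv (m.1 : ℕ) (m.2 : ℕ), finsetSum_coeff]
  refine Finset.sum_congr rfl fun m _ => ?_
  rw [coeff_smul, coeff_zero_foldl_mulThenDeriv (2 * N) (fun p => ((m p).1 : ℕ))
    (fun p => ((m p).2 : ℕ)) 1, map_one, one_mul, smul_eq_mul, D.prod_ends,
    ← Finset.prod_mul_distrib]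
  simp only [hc, chordAt_left, chordAt_right, Sum.elim_inl, Sum.elim_inr]
  rfl

/-- The matching condition for the powers of `∂` and `z` at the end-points of the chords, with
the sign from `D = ∂_left - ∂_right`. -/
noncomputable def derivSign (s : Fin N → ℕ) (k : Fin (2 * N) → ℕ) : ℚ[X] :=
  ∏ i, if k (D.left i) + k (D.right i) = s i then (-1) ^ k (D.right i) else 0

lemma WJ_eq_sum_coeff : D.WJ = ∑ a : Fin (2 * N) → Fin 2,
    (∏ i, CasimirTerm.endWeight (a (D.left i)) (a (D.right i))) *
      ∑ k : Fin (2 * N) → Fin 3,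
        D.derivSign (fun i => (a (D.left i) : ℕ) + a (D.right i)) (fun p => (k p : ℕ)) *
          MvPolynomial.coeff (Finsupp.equivFunOnFinite.symm fun p => (k p : ℕ))
            (∏ p, tailForm p ^ (a p : ℕ)) := by
  rw [WJ]
  simp only [foldl_opAt_apply_zero]
  rw [Finset.sum_comm]
  simp only [← Finset.sum_mul]
  have h : ∀ m : Fin (2 * N) → Fin 2 × Fin 3,
      ∑ ρ : Fin N → CasimirTerm,
        ∏ i, (ρ i).leftCoeff (m (D.left i)) * (ρ i).rightCoeff (m (D.right i)) =
      (∏ i, CasimirTerm.endWeight (m (D.left i)).1 (m (D.right i)).1) *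
        D.derivSign (fun i => ((m (D.left i)).1 : ℕ) + ((m (D.right i)).1 : ℕ))
          (fun p => ((m p).2 : ℕ)) := fun m => by
    rw [derivSign, ← Finset.prod_mul_distrib]
    simp only [← CasimirTerm.sum_leftCoeff_mul_rightCoeff]
    rw [Finset.prod_univ_sum, Fintype.piFinset_univ]
  simp only [h, Finset.mul_sum]
  rw [← (Equiv.arrowProdEquivProdArrow _ (fun _ => Fin 2) (fun _ => Fin 3)).symm.sum_comp,
    Fintype.sum_prod_type]
  refine Finset.sum_congr rfl fun a _ => Finset.sum_congr rfl fun k _ => ?_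
  rw [mul_assoc]
  rfl

/-- The substitution `y_left ↦ x`, `y_right ↦ -x` for the two end-points of each chord. -/
noncomputable def endForm (p : Fin (2 * N)) : MvPolynomial (Fin N) ℚ[X] :=
  Sum.elim (fun i => MvPolynomial.X i) (fun i => -MvPolynomial.X i) (D.chordAt p)

lemma prod_endForm_pow (u : Fin (2 * N) → ℕ) :
    ∏ p, D.endForm p ^ u p = MvPolynomial.monomial
      (Finsupp.equivFunOnFinite.symm fun i => u (D.left i) + u (D.right i))
      (∏ i, (-1 : ℚ[X]) ^ u (D.right i)) := by
  rw [D.prod_ends, ← Finset.prod_mul_distrib, MvPolynomial.monomial_eq, Finsupp.prod_fintype _ _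
    (by simp), map_prod, ← Finset.prod_mul_distrib]
  refine Finset.prod_congr rfl fun i _ => ?_
  simp only [endForm, chordAt_left, chordAt_right, Sum.elim_inl, Sum.elim_inr]
  rw [neg_pow (MvPolynomial.X i : MvPolynomial (Fin N) ℚ[X]), Finsupp.equivFunOnFinite_symm_apply_apply, pow_add]
  rw [map_pow, map_neg, map_one]
  ring

/-- Summing signed coefficients over the exponents at the two end-points of each chord is
substituting the linear forms `endForm`. -/
lemma sum_derivSign_mul_coeff (s : Fin N → ℕ) (hs : ∀ i, s i ≤ 2)
    (P : MvPolynomial (Fin (2 * N)) ℚ[X]) :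
    ∑ k : Fin (2 * N) → Fin 3, D.derivSign s (fun p => (k p : ℕ)) *
      MvPolynomial.coeff (Finsupp.equivFunOnFinite.symm fun p => (k p : ℕ)) P =
    MvPolynomial.coeff (Finsupp.equivFunOnFinite.symm s) (MvPolynomial.aeval D.endForm P) := by
  induction P using MvPolynomial.induction_on' with
  | add p q hp hq => simp only [MvPolynomial.coeff_add, mul_add, Finset.sum_add_distrib, hp, hq,
      map_add]
  | monomial u c =>
    classical
    have hR : MvPolynomial.coeff (Finsupp.equivFunOnFinite.symm s)
        (MvPolynomial.aeval D.endForm (MvPolynomial.monomial u c)) = D.derivSign s u * c := by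
      rw [MvPolynomial.aeval_monomial, Finsupp.prod_fintype _ _ (by simp), prod_endForm_pow,
        MvPolynomial.algebraMap_eq, MvPolynomial.coeff_C_mul, MvPolynomial.coeff_monomial,
        mul_comm, derivSign]
      congr 1
      by_cases h : ∀ i, u (D.left i) + u (D.right i) = s i
      · simp [h]
      · rw [if_neg]
        · push Not at h
          obtain ⟨i, hi⟩ := h
          exact (Finset.prod_eq_zero (Finset.mem_univ i) (if_neg hi)).symm
        · intro h'
          exact h (congrFun (Finsupp.equivFunOnFinite.symm.injective h'))
    rw [hR]
    by_cases hu : ∀ p, u p < 3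
    · rw [Finset.sum_eq_single (fun p => (⟨u p, hu p⟩ : Fin 3))]
      · rw [MvPolynomial.coeff_monomial, if_pos (by ext; simp)]
      · intro k _ hk
        rw [MvPolynomial.coeff_monomial, if_neg, mul_zero]
        rintro rfl
        exact hk (by ext; simp)
      · simp
    · push Not at hu
      obtain ⟨p, hp⟩ := hu
      have h0 : D.derivSign s u = 0 := by
        obtain ⟨i, rfl⟩ | ⟨i, rfl⟩ := D.left_or_right p <;>
        exact Finset.prod_eq_zero (Finset.mem_univ i) (if_neg (by have := hs i; omega))
      rw [h0, zero_mul]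
      refine Finset.sum_eq_zero fun k _ => ?_
      rw [MvPolynomial.coeff_monomial, if_neg, mul_zero]
      rintro rfl
      have := (k p).2
      simp at hp
      omega

/-- The end-point `p` lies on the chord `v`, and it is not the left end-point of `v`. -/
def Covers (v : Fin N) (p : Fin (2 * N)) : Prop := D.left v < p ∧ p ≤ D.right v

open Classical in
lemma aeval_tailForm (p : Fin (2 * N)) : MvPolynomial.aeval D.endForm (tailForm p) =
    -∑ v, if D.Covers v p then MvPolynomial.X v else 0 := by
  rw [tailForm, map_sum, ← Finset.filter_le_eq_Ici, Finset.sum_filter]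
  simp only [MvPolynomial.aeval_X]
  rw [D.sum_ends, ← Finset.sum_add_distrib, ← Finset.sum_neg_distrib]
  refine Finset.sum_congr rfl fun v _ => ?_
  have := D.left_lt_right v
  simp only [endForm, chordAt_left, chordAt_right, Sum.elim_inl, Sum.elim_inr, Covers]
  by_cases h1 : p ≤ D.left v
  · have h2 : p ≤ D.right v := h1.trans this.le
    simp [h1, h2, not_lt.mpr h1]
  · by_cases h2 : p ≤ D.right v <;> simp [h1, h2, not_le.mp h1]

open Classical in
lemma WJ_eq_sum_coeff_prod : D.WJ = ∑ a : Fin (2 * N) → Fin 2,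
    (∏ i, CasimirTerm.endWeight (a (D.left i)) (a (D.right i))) *
      MvPolynomial.coeff
        (Finsupp.equivFunOnFinite.symm fun i => (a (D.left i) : ℕ) + a (D.right i))
        (∏ p, (-∑ v, if D.Covers v p then MvPolynomial.X v else 0) ^ (a p : ℕ)) := by
  rw [WJ_eq_sum_coeff]
  refine Finset.sum_congr rfl fun a _ => ?_
  rw [sum_derivSign_mul_coeff _ _ fun i => by omega, map_prod]
  simp only [map_pow, aeval_tailForm]

end ChordDiagram

/-! ## The weight system as a sum over partial functions -/

/-- `1` for `some`, and `0` for `none`. -/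
def Option.indicator {α : Type*} (o : Option α) : Fin 2 := if o.isSome then 1 else 0

namespace ChordDiagram

variable {N : ℕ} (D : ChordDiagram N)

/-- A partial function from end-points to chords is balanced if every end-point lies on the chord
it is sent to, and every chord is the value at as many end-points as it has end-points in the
domain. -/
structure Balanced (σ : Fin (2 * N) → Option (Fin N)) : Prop where
  covers : ∀ p v, σ p = some v → D.Covers v p
  card_fiber : ∀ v, (Finset.univ.filter fun p => σ p = some v).card =
    ((σ (D.left v)).indicator : ℕ) + (σ (D.right v)).indicator

open Classical in
/-- The term of `(-∑ v, [D.Covers v p] X_v) ^ a` given by the choice of `v`, or by none. -/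
noncomputable def choiceTerm (p : Fin (2 * N)) : Option (Fin N) → MvPolynomial (Fin N) ℚ[X]
  | none => 1
  | some v => if D.Covers v p then -MvPolynomial.X v else 0

open Classical in
lemma linearForm_pow (p : Fin (2 * N)) (a : Fin 2) :
    (-∑ v, if D.Covers v p then MvPolynomial.X v else 0 : MvPolynomial (Fin N) ℚ[X]) ^ (a : ℕ) =
      ∑ o : Option (Fin N), if o.indicator = a then D.choiceTerm p o else 0 := by
  rw [Fintype.sum_option]
  fin_cases a
  · simp [Option.indicator, choiceTerm]
  · simp only [Option.indicator, choiceTerm, ← Finset.sum_neg_distrib]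
    simp [neg_ite]

open Classical in
lemma prod_choiceTerm (σ : Fin (2 * N) → Option (Fin N)) :
    ∏ p, D.choiceTerm p (σ p) = if ∀ p v, σ p = some v → D.Covers v p then
      MvPolynomial.monomial (Finsupp.equivFunOnFinite.symm
        fun v => (Finset.univ.filter fun p => σ p = some v).card)
        (∏ p, (-1 : ℚ[X]) ^ ((σ p).indicator : ℕ)) else 0 := by
  split_ifs with h
  · have hT : ∀ p, D.choiceTerm p (σ p) = MvPolynomial.C ((-1 : ℚ[X]) ^ ((σ p).indicator : ℕ)) *
        MvPolynomial.monomial ((σ p).elim 0 fun v => Finsupp.single v 1) 1 := fun p => by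
      rcases hp : σ p with _ | v
      · simp [choiceTerm, Option.indicator]
      · simp [choiceTerm, Option.indicator, h p v hp, ← MvPolynomial.X.eq_def,
          neg_one_mul (MvPolynomial.X v : MvPolynomial (Fin N) ℚ[X])]
    have hexp : ∑ p, (σ p).elim 0 (fun v => Finsupp.single v 1) = Finsupp.equivFunOnFinite.symm
        fun v => (Finset.univ.filter fun p => σ p = some v).card := by
      ext v
      rw [Finsupp.finsetSum_apply, Finsupp.equivFunOnFinite_symm_apply_apply, Finset.card_filter]
      refine Finset.sum_congr rfl fun p _ => ?_
      rcases σ p with _ | w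
      · simp
      · simp [Finsupp.single_apply]
    rw [Finset.prod_congr rfl fun p _ => hT p, Finset.prod_mul_distrib, ← map_prod,
      ← MvPolynomial.monomial_sum_one, MvPolynomial.C_mul_monomial, mul_one, hexp]
  · push Not at h
    obtain ⟨p, v, hp, hv⟩ := h
    exact Finset.prod_eq_zero (Finset.mem_univ p) (by simp [hp, choiceTerm, hv])

lemma endWeight_mul_sign (a b : Fin 2) :
    CasimirTerm.endWeight a b * ((-1) ^ (a : ℕ) * (-1) ^ (b : ℕ)) =
      (-1) ^ (b : ℕ) * if (a : ℕ) + b = 2 then 2 else X + 2 := by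
  fin_cases a <;> fin_cases b <;> simp [CasimirTerm.endWeight]

open Classical in
lemma WJ_eq_sum_balanced : D.WJ = ∑ σ : Fin (2 * N) → Option (Fin N) with D.Balanced σ,
    ∏ i, (-1 : ℚ[X]) ^ ((σ (D.right i)).indicator : ℕ) *
      if ((σ (D.left i)).indicator : ℕ) + (σ (D.right i)).indicator = 2 then 2 else X + 2 := by
  rw [WJ_eq_sum_coeff_prod]
  have hprod : ∀ a : Fin (2 * N) → Fin 2,
      ∏ p, (-∑ v, if D.Covers v p then MvPolynomial.X v else 0 :
        MvPolynomial (Fin N) ℚ[X]) ^ (a p : ℕ) =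
      ∑ σ : Fin (2 * N) → Option (Fin N),
        if (fun p => (σ p).indicator) = a then ∏ p, D.choiceTerm p (σ p) else 0 := fun a => by
    simp only [linearForm_pow]
    rw [Finset.prod_univ_sum, Fintype.piFinset_univ]
    refine Finset.sum_congr rfl fun σ _ => ?_
    rw [Finset.prod_ite_zero]
    simp [funext_iff]
  simp only [hprod, MvPolynomial.coeff_sum, Finset.mul_sum, apply_ite (MvPolynomial.coeff _),
    MvPolynomial.coeff_zero, mul_ite, mul_zero]
  rw [Finset.sum_comm, Finset.sum_filter]
  refine Finset.sum_congr rfl fun σ _ => ?_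
  rw [Finset.sum_ite_eq, if_pos (Finset.mem_univ _), prod_choiceTerm]
  by_cases hc : ∀ p v, σ p = some v → D.Covers v p
  · rw [if_pos hc, MvPolynomial.coeff_monomial]
    by_cases hf : ∀ v, (Finset.univ.filter fun p => σ p = some v).card =
        ((σ (D.left v)).indicator : ℕ) + (σ (D.right v)).indicator
    · rw [if_pos (by rw [funext hf]), if_pos ⟨hc, hf⟩, D.prod_ends, ← Finset.prod_mul_distrib,
        ← Finset.prod_mul_distrib]
      exact Finset.prod_congr rfl fun i _ => (endWeight_mul_sign _ _).trans (mul_ite _ _ _ _)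
    · rw [if_neg fun h => hf (congrFun (Finsupp.equivFunOnFinite.symm.injective h)),
        if_neg fun h => hf h.card_fiber, mul_zero]
  · rw [if_neg hc, if_neg fun h => hc h.covers, MvPolynomial.coeff_zero, mul_zero]

end ChordDiagram

/-! ## Partial functions and acceptable objects -/

namespace ThickArc

variable {V : Type*}

/-- The end of a thickened arc at which it is not thickened. -/
def thinEnd (e : ThickArc V) : V := if e.atSrc = true then e.tgt else e.src

end ThickArc

namespace RedDigraph

variable {V : Type*} [DecidableEq V]

lemma deg_eq_thickDeg_add (K : Finset (ThickArc V)) (v : V) :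
    deg K v = thickDeg K v + (K.filter fun e => e.thinEnd = v).card := by
  simp only [deg, thickDeg, Finset.card_filter, ← Finset.sum_add_distrib]
  refine Finset.sum_congr rfl fun e _ => ?_
  rcases e with ⟨s, t, _ | _⟩
  · simp [ThickArc.thickEnd, ThickArc.thinEnd, add_comm]
  · simp [ThickArc.thickEnd, ThickArc.thinEnd]

end RedDigraph

namespace ChordDiagram

variable {N : ℕ} (D : ChordDiagram N)

/-- The chord of which `p` is an end-point. -/
noncomputable def chordOf (p : Fin (2 * N)) : Fin N := Sum.elim id id (D.chordAt p)

lemma chordOf_left (i : Fin N) : D.chordOf (D.left i) = i := by simp [chordOf, chordAt_left]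

lemma chordOf_right (i : Fin N) : D.chordOf (D.right i) = i := by simp [chordOf, chordAt_right]

/-- The end-point assigned to a thickened arc: the right end-point of the chord at which it is
thickened if it leaves this chord, and the left one if it enters. -/
def thickPoint (e : ThickArc (Fin N)) : Fin (2 * N) :=
  if e.atSrc = true then D.right e.src else D.left e.tgt

lemma chordOf_thickPoint (e : ThickArc (Fin N)) : D.chordOf (D.thickPoint e) = e.thickEnd := by
  unfold thickPoint ThickArc.thickEnd
  split_ifs
  exacts [D.chordOf_right _, D.chordOf_left _]

lemma isRight_thickPoint (e : ThickArc (Fin N)) :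
    (D.chordAt (D.thickPoint e)).isRight = e.atSrc := by
  unfold thickPoint
  split_ifs with h <;> simp [chordAt_left, chordAt_right, h]

lemma thickPoint_eq_iff (e f : ThickArc (Fin N)) :
    D.thickPoint e = D.thickPoint f ↔ e.thickEnd = f.thickEnd ∧ e.atSrc = f.atSrc := by
  refine ⟨fun h => ?_, fun h => ?_⟩
  · rw [← chordOf_thickPoint D, ← isRight_thickPoint D, h, chordOf_thickPoint,
      isRight_thickPoint]
    exact ⟨rfl, rfl⟩
  · obtain ⟨h, h'⟩ := h
    rcases e with ⟨s, t, _ | _⟩ <;> rcases f with ⟨s', t', _ | _⟩ <;>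
      simp_all [thickPoint, ThickArc.thickEnd]

lemma thickPoint_thinEnd_bijective :
    Function.Bijective fun e : ThickArc (Fin N) => (D.thickPoint e, e.thinEnd) := by
  refine ⟨fun e f h => ?_, fun ⟨p, v⟩ => ?_⟩
  · rw [Prod.mk.injEq, thickPoint_eq_iff] at h
    rcases e with ⟨s, t, _ | _⟩ <;> rcases f with ⟨s', t', _ | _⟩ <;>
      simp_all [ThickArc.thickEnd, ThickArc.thinEnd]
  · obtain ⟨i, rfl⟩ | ⟨i, rfl⟩ := D.left_or_right p
    · exact ⟨⟨v, i, false⟩, by simp [thickPoint, ThickArc.thinEnd]⟩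
    · exact ⟨⟨i, v, true⟩, by simp [thickPoint, ThickArc.thinEnd]⟩

/-- Thickened arcs correspond to pairs of an end-point and a chord. -/
noncomputable def arcEquiv : ThickArc (Fin N) ≃ Fin (2 * N) × Fin N :=
  Equiv.ofBijective _ D.thickPoint_thinEnd_bijective

lemma permitted_iff_covers (e : ThickArc (Fin N)) :
    D.LID.Permitted e ↔ D.Covers e.thinEnd (D.thickPoint e) := by
  rcases e with ⟨s, t, _ | _⟩
  · have h1 := D.left_ne_right t s
    have h2 := D.right_inj (i := t) (j := s)
    have h3 := D.left_lt_right t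
    simp only [RedDigraph.Permitted, LID, CrossesLeft, ContainedIn, Covers, ThickArc.thinEnd,
      thickPoint]
    simp only [Bool.false_eq_true, if_false, and_false, and_true, false_or]
    constructor
    · rintro (h | h)
      · exact ⟨h.1, h.2.1.le⟩
      · exact ⟨h.1, (h3.trans h.2).le⟩
    · rintro ⟨h, h'⟩
      rcases lt_trichotomy (D.right s) (D.right t) with h4 | h4 | h4
      · exact Or.inl ⟨h, lt_of_le_of_ne h' h1, h4⟩
      · rw [h2.1 h4.symm] at h
        exact absurd h (lt_irrefl _)
      · exact Or.inr ⟨h, h4⟩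
  · have h3 := D.left_lt_right s
    simp only [RedDigraph.Permitted, LID, CrossesLeft, ContainedIn, Covers, ThickArc.thinEnd,
      thickPoint]
    simp only [Bool.true_eq_false, if_true, and_false, and_true, or_false]
    constructor
    · rintro (rfl | h | h)
      · exact ⟨h3, le_rfl⟩
      · exact ⟨h.2.1, h.2.2.le⟩
      · exact ⟨h.1.trans h3, h.2.le⟩
    · rintro ⟨h, h'⟩
      rcases lt_trichotomy (D.left s) (D.left t) with h4 | h4 | h4
      · rcases h'.lt_or_eq with h5 | h5
        · exact Or.inr (Or.inl ⟨h4, h, h5⟩)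
        · exact Or.inl (D.right_inj.1 h5)
      · exact Or.inl (D.left_inj.1 h4)
      · rcases h'.lt_or_eq with h5 | h5
        · exact Or.inr (Or.inr ⟨h4, h5⟩)
        · exact Or.inl (D.right_inj.1 h5)

/-- The graph of a partial function from end-points to chords, as a set of thickened arcs. -/
def graph (σ : Fin (2 * N) → Option (Fin N)) : Finset (ThickArc (Fin N)) :=
  Finset.univ.filter fun e => σ (D.thickPoint e) = some e.thinEnd

lemma mem_graph {σ : Fin (2 * N) → Option (Fin N)} {e : ThickArc (Fin N)} :
    e ∈ D.graph σ ↔ σ (D.thickPoint e) = some e.thinEnd := by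
  simp [graph]

lemma graph_injective : Function.Injective D.graph := fun σ τ h => by
  refine funext fun p => Option.ext fun v => ?_
  obtain ⟨e, he⟩ := D.thickPoint_thinEnd_bijective.2 (p, v)
  obtain ⟨rfl, rfl⟩ := Prod.mk.inj he
  rw [← mem_graph, ← mem_graph, h]

lemma sum_graph (σ : Fin (2 * N) → Option (Fin N)) (g : Fin (2 * N) → Fin N → ℕ) :
    ∑ e ∈ D.graph σ, g (D.thickPoint e) e.thinEnd = ∑ p, (σ p).elim 0 (g p) := by
  rw [graph, Finset.sum_filter]
  refine (D.arcEquiv.sum_comp fun x => if σ x.1 = some x.2 then g x.1 x.2 else 0).trans ?_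
  rw [Fintype.sum_prod_type]
  refine Finset.sum_congr rfl fun p _ => ?_
  rcases h : σ p with _ | v <;> simp [h]

lemma thickDeg_graph (σ : Fin (2 * N) → Option (Fin N)) (v : Fin N) :
    RedDigraph.thickDeg (D.graph σ) v =
      ((σ (D.left v)).indicator : ℕ) + (σ (D.right v)).indicator := by
  simp only [RedDigraph.thickDeg, Finset.card_filter, ← chordOf_thickPoint D]
  rw [D.sum_graph σ fun p _ => if D.chordOf p = v then 1 else 0, D.sum_ends]
  simp only [chordOf_left, chordOf_right]
  rw [Finset.sum_eq_single v, Finset.sum_eq_single v]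
  · rcases σ (D.left v) with _ | _ <;> rcases σ (D.right v) with _ | _ <;>
      simp [Option.indicator]
  · intro i _ hi
    rcases σ (D.right i) with _ | _ <;> simp [hi]
  · simp
  · intro i _ hi
    rcases σ (D.left i) with _ | _ <;> simp [hi]
  · simp

lemma card_thinEnd_graph (σ : Fin (2 * N) → Option (Fin N)) (v : Fin N) :
    ((D.graph σ).filter fun e => e.thinEnd = v).card =
      (Finset.univ.filter fun p => σ p = some v).card := by
  simp only [Finset.card_filter]
  rw [D.sum_graph σ fun _ w => if w = v then 1 else 0]
  refine Finset.sum_congr rfl fun p _ => ?_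
  rcases σ p with _ | _ <;> simp

lemma agree_graph (σ : Fin (2 * N) → Option (Fin N)) :
    RedDigraph.agree (D.graph σ) = ∑ i, ((σ (D.right i)).indicator : ℕ) := by
  simp only [RedDigraph.agree, Finset.card_filter, ← isRight_thickPoint D]
  rw [D.sum_graph σ fun p _ => if (D.chordAt p).isRight = true then 1 else 0, D.sum_ends]
  simp only [chordAt_left, chordAt_right]
  rw [Finset.sum_eq_zero, zero_add]
  · refine Finset.sum_congr rfl fun i _ => ?_
    rcases σ (D.right i) with _ | _ <;> simp [Option.indicator]
  · intro i _
    rcases σ (D.left i) with _ | _ <;> simp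

lemma acceptable_graph_iff (σ : Fin (2 * N) → Option (Fin N)) :
    D.LID.Acceptable (D.graph σ) ↔ D.Balanced σ := by
  have hdeg : ∀ v, 2 * RedDigraph.thickDeg (D.graph σ) v = RedDigraph.deg (D.graph σ) v ↔
      (Finset.univ.filter fun p => σ p = some v).card =
        ((σ (D.left v)).indicator : ℕ) + (σ (D.right v)).indicator := fun v => by
    rw [RedDigraph.deg_eq_thickDeg_add, card_thinEnd_graph, ← thickDeg_graph]
    omega
  refine ⟨fun h => ⟨fun p v hp => ?_, fun v => (hdeg v).1 (h.half v)⟩, fun h =>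
    ⟨fun e he => ?_, fun v => ?_, fun v => (hdeg v).2 (h.card_fiber v), ?_⟩⟩
  · obtain ⟨e, he⟩ := D.thickPoint_thinEnd_bijective.2 (p, v)
    obtain ⟨rfl, rfl⟩ := Prod.mk.inj he
    exact (D.permitted_iff_covers e).1 (h.permitted e (D.mem_graph.2 hp))
  · exact (D.permitted_iff_covers e).2 (h.covers _ _ (D.mem_graph.1 he))
  · rw [← (hdeg v).2 (h.card_fiber v), thickDeg_graph]
    omega
  · rintro v e he f hf hne rfl hv hs
    have hp : D.thickPoint e = D.thickPoint f := (D.thickPoint_eq_iff e f).2 ⟨hv.symm, hs⟩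
    rw [mem_graph] at he hf
    rw [hp, hf, Option.some_inj] at he
    exact hne (D.thickPoint_thinEnd_bijective.1 (Prod.ext hp he.symm))

lemma exists_graph_eq {K : Finset (ThickArc (Fin N))} (hK : D.LID.Acceptable K) :
    ∃ σ, D.graph σ = K := by
  classical
  have hinj : ∀ e ∈ K, ∀ f ∈ K, D.thickPoint e = D.thickPoint f → e = f := fun e he f hf h => by
    by_contra hne
    obtain ⟨h1, h2⟩ := (D.thickPoint_eq_iff e f).1 h
    exact hK.enters_leaves _ e he f hf hne h1 rfl h2
  refine ⟨fun p => if h : ∃ e ∈ K, D.thickPoint e = p then some h.choose.thinEnd else none, ?_⟩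
  ext e
  rw [mem_graph]
  constructor
  · intro h
    split_ifs at h with h'
    rw [Option.some_inj] at h
    rw [← D.thickPoint_thinEnd_bijective.1 (Prod.ext h'.choose_spec.2 h)]
    exact h'.choose_spec.1
  · intro he
    have h' : ∃ f ∈ K, D.thickPoint f = D.thickPoint e := ⟨e, he, rfl⟩
    rw [dif_pos h', hinj _ h'.choose_spec.1 e he h'.choose_spec.2]

open Classical in
/-- The weight system as a sum over all acceptable objects, in terms of `d = X + 2`. -/
lemma WJ_eq_sum_acceptable : D.WJ = ∑ K : Finset (ThickArc (Fin N)) with D.LID.Acceptable K,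
    (-1) ^ RedDigraph.agree K *
      (2 ^ RedDigraph.deg4 K * (X + 2) ^ (N - RedDigraph.deg4 K)) := by
  rw [WJ_eq_sum_balanced]
  refine Finset.sum_bij (fun σ _ => D.graph σ) ?_ ?_ ?_ ?_
  · intro σ hσ
    simpa [acceptable_graph_iff] using hσ
  · exact fun σ _ τ _ h => D.graph_injective h
  · intro K hK
    obtain ⟨σ, rfl⟩ := D.exists_graph_eq (Finset.mem_filter.1 hK).2
    exact ⟨σ, by simpa [acceptable_graph_iff] using hK, rfl⟩
  · intro σ hσ
    have hacc := (D.acceptable_graph_iff σ).2 (Finset.mem_filter.1 hσ).2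
    have hdeg : ∀ v, (((σ (D.left v)).indicator : ℕ) + (σ (D.right v)).indicator = 2) ↔
        RedDigraph.deg (D.graph σ) v = 4 := fun v => by
      rw [← hacc.half v, thickDeg_graph]
      omega
    simp only [hdeg]
    rw [Finset.prod_mul_distrib, Finset.prod_pow_eq_pow_sum, agree_graph, Finset.prod_ite,
      Finset.prod_const, Finset.prod_const, Finset.filter_not,
      Finset.card_sdiff_of_subset (Finset.filter_subset _ _), Finset.card_univ, Fintype.card_fin]
    rfl

lemma deg4_le (K : Finset (ThickArc (Fin N))) : RedDigraph.deg4 K ≤ N :=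
  (Finset.card_filter_le _ _).trans (by simp)

open Classical in
lemma WJd_eq_sum_acceptable : D.WJd = ∑ K : Finset (ThickArc (Fin N)) with D.LID.Acceptable K,
    C ((-1) ^ RedDigraph.agree K * 2 ^ RedDigraph.deg4 K) * X ^ (N - RedDigraph.deg4 K) := by
  rw [WJd, WJ_eq_sum_acceptable, Polynomial.sum_comp]
  refine Finset.sum_congr rfl fun K _ => ?_
  simp [mul_assoc, show (C (2 : ℚ) : ℚ[X]) = 2 from map_ofNat C 2]

end ChordDiagram

theorem corollary2 {N : ℕ} (D : ChordDiagram N) (n : ℕ) :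
    ChordDiagram.WJJ n D =
      2 ^ n * ∑ K ∈ D.LID.acceptableWithDeg4 n, (-1 : ℚ) ^ RedDigraph.agree K := by
  classical
  have hset : D.LID.acceptableWithDeg4 n =
      (Finset.univ.filter fun K => D.LID.Acceptable K).filter fun K => RedDigraph.deg4 K = n := by
    ext K
    simp [RedDigraph.acceptableWithDeg4]
  rw [ChordDiagram.WJJ, hset]
  split_ifs with hn
  · rw [ChordDiagram.WJd_eq_sum_acceptable, finsetSum_coeff, Finset.mul_sum,
      Finset.sum_filter _ fun K => _ * _]
    refine Finset.sum_congr rfl fun K _ => ?_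
    have hK := ChordDiagram.deg4_le K
    rw [coeff_C_mul, coeff_X_pow]
    by_cases h : RedDigraph.deg4 K = n
    · rw [if_pos (by omega), if_pos h, h, mul_one, mul_comm]
    · rw [if_neg (by omega), if_neg h, mul_zero]
  · rw [Finset.filter_false_of_mem, Finset.sum_empty, mul_zero]
    rintro K - rfl
    exact hn (ChordDiagram.deg4_le K)
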